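/- Let $T\ge 1$ be an integer and $\rho_{\mathrm{sr}1},\rho_{\mathrm{sr}2},\rho_{\mathrm{rd}1},\rho_{\mathrm{rd}2}\ge 0$. The noncoherent 2-relay diamond network with coherence time $T$ acts on blocks of $T$ complex symbols by $$Y_{R_i}=g_{\mathrm{sr}i}X_S+W_{R_i}\ (i=1,2),\qquad Y_D=g_{\mathrm{rd}1}X_{R_1}+g_{\mathrm{rd}2}X_{R_2}+W_D ,$$ where $X_S,X_{R_i},Y_{R_i},Y_D,W_{R_i},W_D\in\mathbb C^{1\times T}$, the gains $g_{\mathrm{sr}i}\sim\mathcal{CN}(0,\rho_{\mathrm{sr}i}^2)$, $g_{\mathrm{rd}i}\sim\mathcal{CN}(0,\rho_{\mathrm{rd}i}^2)$ and the noise entries, distributed as $\mathcal{CN}(0,1)$, are all independent, the gains are constant within a block, and gains and noise are drawn afresh and independently in each block; no node knows the gains. Write $\underline X=(X_S,X_{R_1},X_{R_2})$, $\underline X_R=(X_{R_1},X_{R_2})$, $\underline Y_R=(Y_{R_1},Y_{R_2})$. A code over $n$ blocks with $M$ messages consists of an encoder mapping a message to the $n$ blocks sent by the source, for each relay a measurable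 rule by which every symbol that it sends is a function of the symbols that it received at strictly earlier times (possibly in the same block), and a measurable decoder that estimates the message from the $n$ blocks received at the destination. For a message uniform on the $M$ messages, the expected total energy sent over the $n$ blocks by the source and by each relay is at most $nT$ (unit average power). A rate $R\ge 0$ is achievable if there are such codes with $\lceil 2^{nTR}\rceil$ messages, $n=0,1,2,\dots$, whose error probabilities tend to $0$ as $n\to\infty$; the capacity $C$ (bits per symbol) is the supremum of the achievable rates. Then $$T\,C\;\le\;\sup_{p(\underline X)}\min\bigl\{\,I(X_S;\underline Y_R),\; I(X_S;Y_{R_2})+I(X_{R_1};Y_D\mid X_{R_2}),\; I(X_S;Y_{R_1})+I(X_{R_2};Y_D\mid X_{R_1}),\; I(\underline X_R;Y_D)\bigr\},$$ where the supremum is over all joint laws of $\underline X$ on $(\mathbb C^{1\times T})^3$ with $\mathbb E\|X_S\|^2=\mathbb E\|X_{R_1}\|^2=\mathbb E\|X_{R_2}\|^2=T$, $\underline X$ is independent of the gains and noise of the block, and mutual information is in bits. -/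

import Mathlib

open MeasureTheory ProbabilityTheory Filter Topology
open scoped NNReal ENNReal

noncomputable section

namespace DiamondNetwork

/-! ### Information measures, in bits -/

/-- Mutual information `I(X;Y) = D(P_{XY} ‖ P_X × P_Y)`, in bits. -/
def mutualInfo {Ω α β : Type*} [MeasurableSpace Ω] [MeasurableSpace α] [MeasurableSpace β]
    (X : Ω → α) (Y : Ω → β) (P : Measure Ω) : ℝ≥0∞ :=
  InformationTheory.klDiv (P.map fun ω => (X ω, Y ω)) ((P.map X).prod (P.map Y)) /
    ENNReal.ofReal (Real.log 2)

/-- Conditional mutual information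
`I(X;Y|Z) = D(P_{ZXY} ‖ P_Z ⊗ (P_{X|Z} × P_{Y|Z}))`, in bits. -/
def condMutualInfo {Ω α β γ : Type*} [MeasurableSpace Ω]
    [MeasurableSpace α] [StandardBorelSpace α] [Nonempty α]
    [MeasurableSpace β] [StandardBorelSpace β] [Nonempty β] [MeasurableSpace γ]
    (X : Ω → α) (Y : Ω → β) (Z : Ω → γ) (P : Measure Ω) [IsFiniteMeasure P] : ℝ≥0∞ :=
  InformationTheory.klDiv (P.map fun ω => (Z ω, (X ω, Y ω)))
      ((P.map Z) ⊗ₘ ((condDistrib X Z P) ×ₖ (condDistrib Y Z P))) /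
    ENNReal.ofReal (Real.log 2)

/-! ### The block-fading channel -/

/-- Circularly symmetric complex Gaussian law `CN(0, v)`: independent real and imaginary parts,
each of variance `v / 2`. -/
def complexGaussian (v : ℝ≥0) : Measure ℂ :=
  ((gaussianReal 0 (v / 2)).prod (gaussianReal 0 (v / 2))).map
    fun q : ℝ × ℝ => (⟨q.1, q.2⟩ : ℂ)

instance (v : ℝ≥0) : IsProbabilityMeasure (complexGaussian v) :=
  Measure.isProbabilityMeasure_map Complex.measurableEquivRealProd.symm.measurable.aemeasurable

/-- A `1 × T` vector of symbols (one coherence block). -/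
abbrev Block (T : ℕ) : Type := Fin T → ℂ

/-- The channel randomness in one block: source-relay gains, relay-destination gains, noise
vectors at the two relays, noise vector at the destination. -/
abbrev Fading (T : ℕ) : Type :=
  (Fin 2 → ℂ) × (Fin 2 → ℂ) × (Fin 2 → Block T) × Block T

/-- Law of the channel randomness in one block: all gains and noise samples are independent,
`g_{sr i} ∼ CN(0, ρsr i ^ 2)`, `g_{rd i} ∼ CN(0, ρrd i ^ 2)`, and the noise is `CN(0, 1)`. -/
def fadingLaw (T : ℕ) (ρsr ρrd : Fin 2 → ℝ≥0) : Measure (Fading T) :=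
  (Measure.pi fun i => complexGaussian (ρsr i ^ 2)).prod
    ((Measure.pi fun i => complexGaussian (ρrd i ^ 2)).prod
      ((Measure.pi fun _ => Measure.pi fun _ => complexGaussian 1).prod
        (Measure.pi fun _ => complexGaussian 1)))

instance (T : ℕ) (ρsr ρrd : Fin 2 → ℝ≥0) : IsProbabilityMeasure (fadingLaw T ρsr ρrd) := by
  unfold fadingLaw; infer_instance

/-- Block received at relay `i`: `Y_{R_i} = g_{sr i} X_S + W_{R_i}`. -/
def relayOut {T : ℕ} (z : Fading T) (xS : Block T) (i : Fin 2) : Block T :=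
  fun t => z.1 i * xS t + z.2.2.1 i t

/-- Block received at the destination: `Y_D = g_{rd 1} X_{R_1} + g_{rd 2} X_{R_2} + W_D`. -/
def destOut {T : ℕ} (z : Fading T) (xR : Fin 2 → Block T) : Block T :=
  fun t => (∑ i, z.2.1 i * xR i t) + z.2.2.2 t

/-- Energy `‖x‖²` of a block. -/
def energy {T : ℕ} (x : Block T) : ℝ≥0∞ := ∑ t, ‖x t‖ₑ ^ 2

/-! ### Codes and capacity -/

/-- A code over `n` blocks of `T` symbols with `M` messages. The symbol sent by a relay at
position `t` of block `k` is a function of the symbols this relay received at strictly earlier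
times, which may lie in previous blocks or in the same block `k`. -/
structure Code (T n M : ℕ) where
  enc : Fin M → Fin n → Block T
  relay : Fin 2 → (Fin n → Block T) → Fin n → Block T
  relay_measurable : ∀ i, Measurable (relay i)
  relay_causal : ∀ (i : Fin 2) (y y' : Fin n → Block T) (k : Fin n) (t : Fin T),
    (∀ (k' : Fin n) (t' : Fin T), k' < k ∨ (k' = k ∧ t' < t) → y k' t' = y' k' t') →
      relay i y k t = relay i y' k t
  dec : (Fin n → Block T) → Fin M
  dec_measurable : Measurable dec

namespace Code

variable {T n M : ℕ}

/-- Blocks sent by the two relays when message `m` is sent and the channel realization is `z`. -/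
def relayTx (c : Code T n M) (m : Fin M) (z : Fin n → Fading T) (i : Fin 2) : Fin n → Block T :=
  c.relay i fun k => relayOut (z k) (c.enc m k) i

/-- Blocks received at the destination. -/
def destRx (c : Code T n M) (m : Fin M) (z : Fin n → Fading T) : Fin n → Block T :=
  fun k => destOut (z k) fun i => c.relayTx m z i k

/-- The gains and noises of different blocks are independent. -/
def channelLaw (T n : ℕ) (ρsr ρrd : Fin 2 → ℝ≥0) : Measure (Fin n → Fading T) :=
  Measure.pi fun _ => fadingLaw T ρsr ρrd

/-- Average error probability for a uniformly distributed message. -/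
def errorProb (c : Code T n M) (ρsr ρrd : Fin 2 → ℝ≥0) : ℝ≥0∞ :=
  (∑ m, channelLaw T n ρsr ρrd {z | c.dec (c.destRx m z) ≠ m}) / M

/-- Unit average transmit power at the source and at both relays: the expected energy, over a
uniform message and the channel, of the `n` transmitted blocks is at most `n T`. -/
def MeetsPower (c : Code T n M) (ρsr ρrd : Fin 2 → ℝ≥0) : Prop :=
  (∑ m, ∑ k, energy (c.enc m k)) / M ≤ n * T ∧
  ∀ i, (∑ m, ∫⁻ z, ∑ k, energy (c.relayTx m z i k) ∂(channelLaw T n ρsr ρrd)) / M ≤ n * T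

end Code

/-- The rate `R` (bits per symbol) is achievable: there are codes over `n = 0, 1, 2, …` blocks
with `⌈2 ^ (n T R)⌉` messages, unit average transmit powers, and vanishing error probability. -/
def Achievable (T : ℕ) (ρsr ρrd : Fin 2 → ℝ≥0) (R : ℝ≥0) : Prop :=
  ∃ c : (n : ℕ) → Code T n ⌈(2 : ℝ) ^ ((n : ℝ) * T * R)⌉₊,
    (∀ n, (c n).MeetsPower ρsr ρrd) ∧
    Tendsto (fun n => (c n).errorProb ρsr ρrd) atTop (𝓝 0)

/-- Capacity in bits per symbol: the supremum of the achievable rates. -/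
def capacity (T : ℕ) (ρsr ρrd : Fin 2 → ℝ≥0) : ℝ≥0∞ :=
  ⨆ (R : ℝ≥0) (_ : Achievable T ρsr ρrd R), (R : ℝ≥0∞)

/-! ### The one-block quantities in the bound -/

/-- Input `X = (X_S, (X_{R_1}, X_{R_2}))` of one block. -/
abbrev Input (T : ℕ) : Type := Block T × (Fin 2 → Block T)

/-- Unit average power for an input law: `E‖X_S‖² = E‖X_{R_1}‖² = E‖X_{R_2}‖² = T`. -/
def UnitPower {T : ℕ} (p : ProbabilityMeasure (Input T)) : Prop :=
  ∫⁻ x, energy x.1 ∂(p : Measure (Input T)) = T ∧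
  ∀ i, ∫⁻ x, energy (x.2 i) ∂(p : Measure (Input T)) = T

/-- Joint law of an input with law `p` and of independent channel randomness. -/
def jointLaw {T : ℕ} (ρsr ρrd : Fin 2 → ℝ≥0) (p : ProbabilityMeasure (Input T)) :
    Measure (Input T × Fading T) :=
  (p : Measure (Input T)).prod (fadingLaw T ρsr ρrd)

instance {T : ℕ} (ρsr ρrd : Fin 2 → ℝ≥0) (p : ProbabilityMeasure (Input T)) :
    IsProbabilityMeasure (jointLaw ρsr ρrd p) := by
  unfold jointLaw; infer_instance

variable {T : ℕ}

/-- `X_S`. -/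
def XS (ω : Input T × Fading T) : Block T := ω.1.1

/-- `X_R = (X_{R_1}, X_{R_2})`; `XR ω i` is the input of relay `i`. -/
def XR (ω : Input T × Fading T) : Fin 2 → Block T := ω.1.2

/-- `Y_R = (Y_{R_1}, Y_{R_2})`; `YR ω i` is the output at relay `i`. -/
def YR (ω : Input T × Fading T) : Fin 2 → Block T := relayOut ω.2 ω.1.1

/-- `Y_D`. -/
def YD (ω : Input T × Fading T) : Block T := destOut ω.2 ω.1.2

/-- `min { I(X_S;Y_R), I(X_S;Y_{R_2}) + I(X_{R_1};Y_D|X_{R_2}),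
I(X_S;Y_{R_1}) + I(X_{R_2};Y_D|X_{R_1}), I(X_R;Y_D) }`; the relays 1, 2 have indices 0, 1. -/
def minCut (P : Measure (Input T × Fading T)) [IsFiniteMeasure P] : ℝ≥0∞ :=
  min
    (min (mutualInfo XS YR P)
      (mutualInfo XS (fun ω => YR ω 1) P +
        condMutualInfo (fun ω => XR ω 0) YD (fun ω => XR ω 1) P))
    (min
      (mutualInfo XS (fun ω => YR ω 0) P +
        condMutualInfo (fun ω => XR ω 1) YD (fun ω => XR ω 0) P)
      (mutualInfo XR YD P))

end DiamondNetwork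

end

noncomputable section

namespace DiamondNetwork

open InformationTheory

/-! ### Kullback-Leibler divergence of kernels and products -/

section KL

variable {α β : Type*} [MeasurableSpace α] [MeasurableSpace β]

/-! The converse is a change of measure, carried out separately for each cut. Fix a code with `M`
messages and a set `D` of relays, which together with the destination forms the far side of the cut.
Replace the channels by simulated ones through which no information crosses the cut (`CutChannel`).
Under the simulated law the decoder is right with probability at most `1 / M`
(`Code.codeLaw_correct_le`), while under the true law it is right with probability one minus the
error probability. Hence the divergence of the true law from the simulated one is at least (1 -
error) log M - log 2 (`mul_log_sub_log_two_le_klDiv`).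

The network is layered: the message determines the source input, and all the relay outputs together
determine all the relay inputs. The law of message, relay outputs and destination outputs is
therefore a two-stage composition-product, memoryless across blocks at each stage. The chain rule
turns the divergence into a sum over blocks of averaged one-block divergences, that is, into one
integral against the summed block input law `Code.inputLaw` (`Code.klDiv_codeLaw_eq_lintegral`). The
randomness of the relays is independent of that of the destination, so a mixed cut splits into a
relay term and a destination term.

The input law `p` is chosen before the cut: it averages the block inputs of the code and one filler
block that restores equality in the power constraints (`Code.exists_unitPower`). The simulated
channels are then the output laws that `p` induces, conditional on the input of the relay in `D` for
the destination in a mixed cut. With this choice the integral against `p` is exactly the mutual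
information expression of the cut (`IsCutValue`). Since the same `p` serves every cut, the smallest
of the four may be taken, and neither concavity nor a time-sharing variable is needed. Dividing by
`n` and letting `n` tend to infinity removes the filler block and the log 2. -/

lemma klDiv_map_measurableEquiv (e : α ≃ᵐ β) (μ ν : Measure α) [IsFiniteMeasure μ]
    [IsFiniteMeasure ν] : klDiv (μ.map e) (ν.map e) = klDiv μ ν := by
  refine le_antisymm (klDiv_map_le μ ν e.measurable) ?_
  have h := klDiv_map_le (μ.map e) (ν.map e) e.symm.measurable
  simpa [Measure.map_map e.symm.measurable e.measurable] using h

/-- The kernel derivative is jointly measurable in both arguments, unlike a separate choice of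
derivative for each `a`; this is what gives measurability of the divergence in `a`. -/
lemma klDiv_kernel_eq [MeasurableSpace.CountableOrCountablyGenerated α β] (κ η : Kernel α β)
    [IsFiniteKernel κ] [IsFiniteKernel η] {a : α} (h : κ a ≪ η a) :
    klDiv (κ a) (η a) = ∫⁻ b, ENNReal.ofReal (klFun (κ.rnDeriv η a b).toReal) ∂(η a) := by
  rw [klDiv_eq_lintegral_klFun_of_ac h]
  refine lintegral_congr_ae ?_
  filter_upwards [κ.rnDeriv_eq_rnDeriv_measure (η := η) (a := a)] with b hb
  rw [hb]

lemma measurable_klFun_rnDeriv [MeasurableSpace.CountableOrCountablyGenerated α β]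
    (κ η : Kernel α β) :
    Measurable fun p : α × β => ENNReal.ofReal (klFun (κ.rnDeriv η p.1 p.2).toReal) :=
  (measurable_klFun.comp (κ.measurable_rnDeriv η).ennreal_toReal).ennreal_ofReal

lemma measurable_klDiv [MeasurableSpace.CountableOrCountablyGenerated α β] (κ η : Kernel α β)
    [IsFiniteKernel κ] [IsFiniteKernel η] : Measurable fun a => klDiv (κ a) (η a) := by
  classical
  have h : (fun a => klDiv (κ a) (η a)) = fun a => if κ a ≪ η a then
      ∫⁻ b, ENNReal.ofReal (klFun (κ.rnDeriv η a b).toReal) ∂(η a) else ∞ := by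
    ext a
    split_ifs with hac
    · exact klDiv_kernel_eq κ η hac
    · exact klDiv_of_not_ac hac
  rw [h]
  exact Measurable.ite (Kernel.measurableSet_absolutelyContinuous κ η)
    (Measurable.lintegral_kernel_prod_right (measurable_klFun_rnDeriv κ η)) measurable_const

/-- The divergence of two composition-products with the same first marginal is the average
divergence of the kernels. -/
lemma klDiv_compProd_eq_lintegral [MeasurableSpace.CountableOrCountablyGenerated α β]
    (μ : Measure α) [IsFiniteMeasure μ] (κ η : Kernel α β)
    [IsFiniteKernel κ] [IsFiniteKernel η] :
    klDiv (μ ⊗ₘ κ) (μ ⊗ₘ η) = ∫⁻ a, klDiv (κ a) (η a) ∂μ := by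
  by_cases hac : ∀ᵐ a ∂μ, κ a ≪ η a
  · have hac' : μ ⊗ₘ κ ≪ μ ⊗ₘ η := Measure.absolutelyContinuous_compProd_right_iff.mpr hac
    rw [klDiv_eq_lintegral_klFun_of_ac hac']
    have hd : μ ⊗ₘ κ = (μ ⊗ₘ η).withDensity fun p => κ.rnDeriv η p.1 p.2 := by
      ext s hs
      rw [withDensity_apply _ hs, Measure.compProd_apply hs, ← lintegral_indicator hs,
        Measure.lintegral_compProd ((κ.measurable_rnDeriv η).indicator hs)]
      refine lintegral_congr_ae ?_
      filter_upwards [hac] with a ha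
      rw [← Kernel.setLIntegral_rnDeriv ha (measurable_prodMk_left hs),
        ← lintegral_indicator (measurable_prodMk_left hs)]
      rfl
    have hr : (μ ⊗ₘ κ).rnDeriv (μ ⊗ₘ η) =ᵐ[μ ⊗ₘ η] fun p => κ.rnDeriv η p.1 p.2 := by
      conv_lhs => rw [hd]
      exact Measure.rnDeriv_withDensity _ (κ.measurable_rnDeriv η)
    rw [lintegral_congr_ae (g := fun p => ENNReal.ofReal (klFun (κ.rnDeriv η p.1 p.2).toReal))
        (by filter_upwards [hr] with p hp; rw [hp]),
      Measure.lintegral_compProd (measurable_klFun_rnDeriv κ η)]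
    refine lintegral_congr_ae ?_
    filter_upwards [hac] with a ha using (klDiv_kernel_eq κ η ha).symm
  -- Absolute continuity fails on a set of positive measure, so both sides are infinite.
  · rw [klDiv_of_not_ac (by rwa [Measure.absolutelyContinuous_compProd_right_iff])]
    symm
    have hs := (Kernel.measurableSet_absolutelyContinuous κ η).compl
    rw [eq_top_iff]
    calc ∞ = ∫⁻ _ in {a | κ a ≪ η a}ᶜ, ∞ ∂μ := by
          rw [setLIntegral_const, ENNReal.top_mul]
          rwa [ae_iff] at hac
      _ ≤ ∫⁻ a in {a | κ a ≪ η a}ᶜ, klDiv (κ a) (η a) ∂μ := by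
          refine setLIntegral_mono' hs fun a ha => ?_
          rw [klDiv_of_not_ac ha]
      _ ≤ _ := setLIntegral_le_lintegral _ _

lemma klDiv_prod [MeasurableSpace.CountablyGenerated β] (μ μ' : Measure α) (ν ν' : Measure β)
    [IsProbabilityMeasure μ] [IsProbabilityMeasure μ'] [IsProbabilityMeasure ν]
    [IsProbabilityMeasure ν'] :
    klDiv (μ.prod ν) (μ'.prod ν') = klDiv μ μ' + klDiv ν ν' := by
  rw [← Measure.compProd_const, ← Measure.compProd_const, klDiv_compProd_eq_add,
    klDiv_compProd_eq_lintegral]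
  simp

lemma klDiv_pi [StandardBorelSpace β] {n : ℕ} (μ ν : Fin n → Measure β)
    [∀ i, IsProbabilityMeasure (μ i)] [∀ i, IsProbabilityMeasure (ν i)] :
    klDiv (Measure.pi μ) (Measure.pi ν) = ∑ i, klDiv (μ i) (ν i) := by
  induction n with
  | zero =>
    rw [Measure.pi_of_empty, Measure.pi_of_empty]
    simp
  | succ n ih =>
    rw [← klDiv_map_measurableEquiv (MeasurableEquiv.piFinSuccAbove (fun _ => β) 0),
      (measurePreserving_piFinSuccAbove μ 0).map_eq, (measurePreserving_piFinSuccAbove ν 0).map_eq,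
      klDiv_prod, ih, Fin.sum_univ_succ]
    simp

/-- The kernel of products of given Markov kernels. -/
def piKernel {ι : Type*} [Fintype ι] (κ : ι → Kernel α β) [∀ i, IsMarkovKernel (κ i)] :
    Kernel α (ι → β) where
  toFun a := Measure.pi fun i => κ i a
  measurable' := by
    refine Measurable.measure_of_isPiSystem_of_isProbabilityMeasure generateFrom_pi.symm
      isPiSystem_pi ?_
    rintro _ ⟨s, hs, rfl⟩
    simp only [Set.mem_pi, Set.mem_univ, Set.mem_ofPred_eq, true_imp_iff] at hs
    simp only [Measure.pi_pi]
    exact Finset.measurable_fun_prod _ fun i _ => (κ i).measurable_coe (hs i)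

lemma piKernel_apply {ι : Type*} [Fintype ι] (κ : ι → Kernel α β) [∀ i, IsMarkovKernel (κ i)]
    (a : α) : piKernel κ a = Measure.pi fun i => κ i a := rfl

instance {ι : Type*} [Fintype ι] (κ : ι → Kernel α β) [∀ i, IsMarkovKernel (κ i)] :
    IsMarkovKernel (piKernel κ) :=
  ⟨fun a => by rw [piKernel_apply]; infer_instance⟩

/-- A test that accepts with probability at most `1 / M` under `Q` forces a divergence of at least
`P A * log M - log 2`. -/
lemma mul_log_sub_log_two_le_klDiv (P Q : Measure α) [IsProbabilityMeasure P]
    [IsProbabilityMeasure Q] {A : Set α} (hA : MeasurableSet A) {M : ℝ} (hM : 1 ≤ M)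
    (hQ : Q.real A * M ≤ 1) :
    ENNReal.ofReal (P.real A * Real.log M - Real.log 2) ≤ klDiv P Q := by
  by_cases hac : P ≪ Q
  swap
  · simp [klDiv_of_not_ac hac]
  by_cases hint : Integrable (llr P Q) P
  swap
  · simp [klDiv_of_not_integrable hint]
  rw [klDiv_of_ac_of_integrable hac hint]
  refine ENNReal.ofReal_le_ofReal ?_
  -- Test function for the Donsker–Varadhan inequality. Its exponential is `M` on `A` and 1
  -- elsewhere, with `Q`-mean Q(A)(M - 1) + 1 ≤ 2; this is the origin of the log 2.
  set g : α → ℝ := A.indicator fun _ => Real.log M with hg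
  have hgm : Measurable g := measurable_const.indicator hA
  have hexp : (fun x => Real.exp (g x)) = fun x => A.indicator (fun _ => M - 1) x + 1 := by
    ext x
    by_cases hx : x ∈ A
    · simp [hg, hx, Real.exp_log (by linarith : 0 < M)]
    · simp [hg, hx]
  have hgP : Integrable g P := (integrable_const _).indicator hA
  have hi : Integrable (A.indicator fun _ => M - 1) Q := (integrable_const _).indicator hA
  have hgQ : Integrable (fun x => Real.exp (g x)) Q := by
    rw [hexp]; exact hi.add (integrable_const _)
  have hval : ∫ x, Real.exp (g x) ∂Q = Q.real A * (M - 1) + 1 := by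
    rw [hexp, integral_add hi (integrable_const _), integral_indicator hA]
    simp
  have hle : Real.log (∫ x, Real.exp (g x) ∂Q) ≤ Real.log 2 := by
    have h0 : 0 ≤ Q.real A := measureReal_nonneg
    rw [hval]
    exact Real.log_le_log (by nlinarith) (by nlinarith)
  have := isProbabilityMeasure_tilted hgQ
  -- Nonnegativity of the divergence of `P` from `Q` tilted by `g`.
  have hnn := integral_llr_add_sub_measure_univ_nonneg
    (hac.trans (absolutelyContinuous_tilted hgQ)) (integrable_llr_tilted_right hac hgP hint hgQ)
  rw [integral_llr_tilted_right hac hgP hgQ hint] at hnn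
  have hgi : ∫ x, g x ∂P = P.real A * Real.log M := by
    rw [hg, integral_indicator hA]; simp
  rw [hgi] at hnn
  simp only [probReal_univ] at hnn ⊢
  linarith

end KL

/-! ### Kernels given by measurable maps of independent randomness -/

section MapKernel

variable {α β γ δ : Type*} [MeasurableSpace α] [MeasurableSpace β] [MeasurableSpace γ]
  [MeasurableSpace δ]

/-- The kernel `a ↦ ν.map (g a)`. -/
def mapKernel (ν : Measure γ) [IsProbabilityMeasure ν] (g : α → γ → β)
    (_hg : Measurable (Function.uncurry g)) : Kernel α β :=
  (Kernel.id ×ₖ Kernel.const α ν).map (Function.uncurry g)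

variable (ν : Measure γ) [IsProbabilityMeasure ν] {g : α → γ → β}

lemma mapKernel_apply (hg : Measurable (Function.uncurry g)) (a : α) :
    mapKernel ν g hg a = ν.map (g a) := by
  rw [mapKernel, Kernel.map_apply _ hg, Kernel.prod_apply, Kernel.id_apply, Kernel.const_apply,
    Measure.dirac_prod, Measure.map_map hg measurable_prodMk_left]
  rfl

instance (hg : Measurable (Function.uncurry g)) : IsMarkovKernel (mapKernel ν g hg) :=
  Kernel.IsMarkovKernel.map _ hg

lemma measurable_prodMk_comp {f : δ → α} (hf : Measurable f)
    (hg : Measurable (Function.uncurry g)) :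
    Measurable fun p : δ × γ => (f p.1, g (f p.1) p.2) :=
  (hf.comp measurable_fst).prodMk (hg.comp ((hf.comp measurable_fst).prodMk measurable_snd))

/-- By Fubini: the randomness is independent of the input, so given `f = a` the output has the law
of `g a`, whatever else the input carries. This yields the one-block laws as well as the two-stage
law of a code. -/
lemma map_prod_eq_compProd (μ : Measure δ) [IsFiniteMeasure μ] {f : δ → α} (hf : Measurable f)
    (hg : Measurable (Function.uncurry g)) (κ : Kernel α β) [IsSFiniteKernel κ]
    (hκ : ∀ a, ν.map (g a) = κ a) :
    (μ.prod ν).map (fun p => (f p.1, g (f p.1) p.2)) = μ.map f ⊗ₘ κ := by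
  have hm := measurable_prodMk_comp hf hg
  ext s hs
  rw [Measure.map_apply hm hs, Measure.prod_apply (hm hs), Measure.compProd_apply hs,
    lintegral_map (Kernel.measurable_kernel_prodMk_left hs) hf]
  refine lintegral_congr fun x => ?_
  have hx : Measurable (g (f x)) := hg.comp measurable_prodMk_left
  rw [← hκ, Measure.map_apply hx (measurable_prodMk_left hs)]
  rfl

end MapKernel

/-! ### The channel kernels -/

section Channel

variable {T : ℕ} (ρsr ρrd : Fin 2 → ℝ≥0)

/-- Law of the gain and noise of the link from the source to relay `i`. -/
def relayFading (T : ℕ) (i : Fin 2) : Measure (ℂ × Block T) :=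
  (complexGaussian (ρsr i ^ 2)).prod (Measure.pi fun _ => complexGaussian 1)

instance (i : Fin 2) : IsProbabilityMeasure (relayFading ρsr T i) := by
  unfold relayFading; infer_instance

/-- Law of the gains and noise at the destination. -/
def destFading (T : ℕ) : Measure ((Fin 2 → ℂ) × Block T) :=
  (Measure.pi fun i => complexGaussian (ρrd i ^ 2)).prod (Measure.pi fun _ => complexGaussian 1)

instance : IsProbabilityMeasure (destFading ρrd T) := by
  unfold destFading; infer_instance

/-- The channel randomness of a block, sorted by receiver. -/
def splitFading (z : Fading T) : (Fin 2 → ℂ × Block T) × ((Fin 2 → ℂ) × Block T) :=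
  (fun i => (z.1 i, z.2.2.1 i), (z.2.1, z.2.2.2))

/-- Only a reordering of independent factors; it exhibits the randomness of the relays as
independent of that of the destination. -/
lemma measurePreserving_splitFading :
    MeasurePreserving splitFading (fadingLaw T ρsr ρrd)
      ((Measure.pi (relayFading ρsr T)).prod (destFading ρrd T)) := by
  let A := Measure.pi fun i => complexGaussian (ρsr i ^ 2)
  let B := Measure.pi fun i => complexGaussian (ρrd i ^ 2)
  let C : Measure (Fin 2 → Block T) := Measure.pi fun _ => Measure.pi fun _ => complexGaussian 1
  let D : Measure (Block T) := Measure.pi fun _ => complexGaussian 1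
  have h₁ : MeasurePreserving (fun q : (Fin 2 → ℂ) × (Fin 2 → Block T) × Block T =>
      (q.2.1, (q.1, q.2.2))) (B.prod (C.prod D)) (C.prod (B.prod D)) :=
    (measurePreserving_prodAssoc C B D).comp
      (((Measure.measurePreserving_swap (μ := B) (ν := C)).prod (MeasurePreserving.id D)).comp
        ((measurePreserving_prodAssoc B C D).symm MeasurableEquiv.prodAssoc))
  have h₂ : MeasurePreserving (fun z : Fading T => ((z.1, z.2.2.1), (z.2.1, z.2.2.2)))
      (A.prod (B.prod (C.prod D))) ((A.prod C).prod (B.prod D)) :=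
    ((measurePreserving_prodAssoc A C (B.prod D)).symm MeasurableEquiv.prodAssoc).comp
      ((MeasurePreserving.id A).prod h₁)
  have h₃ := (measurePreserving_arrowProdEquivProdArrow ℂ (Block T) (Fin 2)
    (fun i => complexGaussian (ρsr i ^ 2)) (fun _ => Measure.pi fun _ => complexGaussian 1)).symm
  exact (h₃.prod (MeasurePreserving.id (B.prod D))).comp h₂

lemma measurable_relay_map : Measurable (Function.uncurry
    fun (x : Block T) (r : ℂ × Block T) (t : Fin T) => r.1 * x t + r.2 t) := by
  unfold Function.uncurry; fun_prop

lemma measurable_dest_map : Measurable (Function.uncurry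
    fun (x : Fin 2 → Block T) (d : (Fin 2 → ℂ) × Block T) (t : Fin T) =>
      (∑ i, d.1 i * x i t) + d.2 t) := by
  unfold Function.uncurry; fun_prop

/-- The channel from the source to relay `i`. -/
def relayKernel (i : Fin 2) : Kernel (Block T) (Block T) :=
  mapKernel (relayFading ρsr T i) _ measurable_relay_map

instance (i : Fin 2) : IsMarkovKernel (relayKernel ρsr i : Kernel (Block T) (Block T)) := by
  unfold relayKernel; infer_instance

/-- The channel from the source to both relays. -/
def relaysKernel : Kernel (Block T) (Fin 2 → Block T) := piKernel (relayKernel ρsr)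

instance : IsMarkovKernel (relaysKernel ρsr : Kernel (Block T) _) := by
  unfold relaysKernel; infer_instance

/-- The channel from the relays to the destination. -/
def destKernel : Kernel (Fin 2 → Block T) (Block T) :=
  mapKernel (destFading ρrd T) _ measurable_dest_map

instance : IsMarkovKernel (destKernel ρrd : Kernel (Fin 2 → Block T) (Block T)) := by
  unfold destKernel; infer_instance

lemma measurable_relayOut :
    Measurable (Function.uncurry fun (x : Block T) (z : Fading T) => relayOut z x) := by
  unfold Function.uncurry relayOut; fun_prop

lemma pi_relayFading_map (x : Block T) :
    (Measure.pi (relayFading ρsr T)).map (fun r i t => (r i).1 * x t + (r i).2 t) =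
      relaysKernel ρsr x := by
  have hm : Measurable fun (r : ℂ × Block T) (t : Fin T) => r.1 * x t + r.2 t :=
    measurable_relay_map.comp measurable_prodMk_left
  have (i : Fin 2) : IsProbabilityMeasure ((relayFading ρsr T i).map
      fun r t => r.1 * x t + r.2 t) := Measure.isProbabilityMeasure_map hm.aemeasurable
  rw [Measure.pi_map_pi (f := fun _ (r : ℂ × Block T) (t : Fin T) => r.1 * x t + r.2 t)
    fun _ => hm.aemeasurable, relaysKernel, piKernel_apply]
  simp_rw [relayKernel, mapKernel_apply]

lemma destFading_map (x : Fin 2 → Block T) :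
    (destFading ρrd T).map (fun d t => (∑ i, d.1 i * x i t) + d.2 t) = destKernel ρrd x := by
  rw [destKernel, mapKernel_apply]

lemma fadingLaw_map_relayOut (x : Block T) :
    (fadingLaw T ρsr ρrd).map (fun z => relayOut z x) = relaysKernel ρsr x := by
  have hs := measurePreserving_splitFading (T := T) ρsr ρrd
  have hf := measurePreserving_fst.comp hs
  rw [← pi_relayFading_map, ← hf.map_eq, Measure.map_map (by fun_prop) hf.measurable]
  rfl

lemma fadingLaw_map_relayOut_apply (x : Block T) (i : Fin 2) :
    (fadingLaw T ρsr ρrd).map (fun z => relayOut z x i) = relayKernel ρsr i x := by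
  have hm : Measurable fun z : Fading T => relayOut z x :=
    measurable_relayOut.comp measurable_prodMk_left
  have h := Measure.map_map (μ := fadingLaw T ρsr ρrd) (measurable_pi_apply i) hm
  rw [fadingLaw_map_relayOut, relaysKernel, piKernel_apply,
    (measurePreserving_eval (fun i => relayKernel ρsr i x) i).map_eq] at h
  exact h.symm

lemma fadingLaw_map_destOut (x : Fin 2 → Block T) :
    (fadingLaw T ρsr ρrd).map (fun z => destOut z x) = destKernel ρrd x := by
  have hs := measurePreserving_splitFading (T := T) ρsr ρrd
  have hf := measurePreserving_snd.comp hs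
  rw [← destFading_map, ← hf.map_eq, Measure.map_map (by fun_prop) hf.measurable]
  rfl

lemma measurePreserving_splitFading_pi (n : ℕ) : MeasurePreserving
    (fun z : Fin n → Fading T => (fun k => (splitFading (z k)).1, fun k => (splitFading (z k)).2))
    (Code.channelLaw T n ρsr ρrd)
    ((Measure.pi fun _ => Measure.pi (relayFading ρsr T)).prod
      (Measure.pi fun _ => destFading ρrd T)) :=
  (measurePreserving_arrowProdEquivProdArrow _ _ (Fin n)
    (fun _ => Measure.pi (relayFading ρsr T)) (fun _ => destFading ρrd T)).comp
    (measurePreserving_pi _ _ fun _ => measurePreserving_splitFading ρsr ρrd)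

lemma pi_pi_relayFading_map {n : ℕ} (x : Fin n → Block T) :
    (Measure.pi fun _ : Fin n => Measure.pi (relayFading ρsr T)).map
        (fun r k i t => (r k i).1 * x k t + (r k i).2 t) =
      Measure.pi fun k => relaysKernel ρsr (x k) := by
  have hm (k : Fin n) : Measurable fun (r : Fin 2 → ℂ × Block T) (i : Fin 2) (t : Fin T) =>
    (r i).1 * x k t + (r i).2 t := by fun_prop
  have (k : Fin n) : IsProbabilityMeasure ((Measure.pi (relayFading ρsr T)).map
      fun r i t => (r i).1 * x k t + (r i).2 t) :=
    Measure.isProbabilityMeasure_map (hm k).aemeasurable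
  rw [Measure.pi_map_pi (f := fun k (r : Fin 2 → ℂ × Block T) i t =>
    (r i).1 * x k t + (r i).2 t) fun k => (hm k).aemeasurable]
  simp_rw [pi_relayFading_map]

lemma pi_destFading_map {n : ℕ} (x : Fin n → Fin 2 → Block T) :
    (Measure.pi fun _ : Fin n => destFading ρrd T).map
        (fun d k t => (∑ i, (d k).1 i * x k i t) + (d k).2 t) =
      Measure.pi fun k => destKernel ρrd (x k) := by
  have hm (k : Fin n) : Measurable fun (d : (Fin 2 → ℂ) × Block T) (t : Fin T) =>
    (∑ i, d.1 i * x k i t) + d.2 t := by fun_prop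
  have (k : Fin n) : IsProbabilityMeasure ((destFading ρrd T).map
      fun d t => (∑ i, d.1 i * x k i t) + d.2 t) :=
    Measure.isProbabilityMeasure_map (hm k).aemeasurable
  rw [Measure.pi_map_pi (f := fun k (d : (Fin 2 → ℂ) × Block T) t =>
    (∑ i, d.1 i * x k i t) + d.2 t) fun k => (hm k).aemeasurable]
  simp_rw [destFading_map]

/-- The memoryless extension of a kernel to `n` blocks, with inputs given by `F`. -/
def blockKernel {α β γ : Type*} [MeasurableSpace α] [MeasurableSpace β] [MeasurableSpace γ]
    {n : ℕ} (κ : Kernel α β) [IsMarkovKernel κ] (F : γ → Fin n → α) (hF : Measurable F) :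
    Kernel γ (Fin n → β) :=
  piKernel fun k => κ.comap (fun y => F y k) ((measurable_pi_apply k).comp hF)

instance {α β γ : Type*} [MeasurableSpace α] [MeasurableSpace β] [MeasurableSpace γ]
    {n : ℕ} (κ : Kernel α β) [IsMarkovKernel κ] (F : γ → Fin n → α) (hF : Measurable F) :
    IsMarkovKernel (blockKernel κ F hF) := by
  unfold blockKernel; infer_instance

lemma blockKernel_apply {α β γ : Type*} [MeasurableSpace α] [MeasurableSpace β]
    [MeasurableSpace γ] {n : ℕ} (κ : Kernel α β) [IsMarkovKernel κ] (F : γ → Fin n → α)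
    (hF : Measurable F) (y : γ) : blockKernel κ F hF y = Measure.pi fun k => κ (F y k) := rfl

/-- Joint law, over several blocks, of the relay outputs and of the destination outputs when the
relays apply the map `F`. -/
lemma channelLaw_map_outputs {n : ℕ} (x : Fin n → Block T)
    {F : (Fin n → Fin 2 → Block T) → Fin n → Fin 2 → Block T} (hF : Measurable F) :
    (Code.channelLaw T n ρsr ρrd).map (fun z => (fun k => relayOut (z k) (x k),
        fun k => destOut (z k) (F (fun k => relayOut (z k) (x k)) k))) =
      (Measure.pi fun k => relaysKernel ρsr (x k)) ⊗ₘ blockKernel (destKernel ρrd) F hF := by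
  have hs := measurePreserving_splitFading_pi (T := T) ρsr ρrd n
  let f : (Fin n → Fin 2 → ℂ × Block T) → Fin n → Fin 2 → Block T :=
    fun r k i t => (r k i).1 * x k t + (r k i).2 t
  let g : (Fin n → Fin 2 → Block T) → (Fin n → (Fin 2 → ℂ) × Block T) → Fin n → Block T :=
    fun y d k t => (∑ i, (d k).1 i * F y k i t) + (d k).2 t
  have hf : Measurable f := by fun_prop
  have hg : Measurable (Function.uncurry g) := by
    unfold Function.uncurry
    fun_prop
  have hκ (y : Fin n → Fin 2 → Block T) : (Measure.pi fun _ => destFading ρrd T).map (g y) =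
      blockKernel (destKernel ρrd) F hF y := by
    rw [blockKernel_apply, ← pi_destFading_map]
  have key := map_prod_eq_compProd (Measure.pi fun _ => destFading ρrd T)
    (Measure.pi fun _ : Fin n => Measure.pi (relayFading ρsr T)) hf hg
    (blockKernel (destKernel ρrd) F hF) hκ
  have hm := measurable_prodMk_comp hf hg
  rw [pi_pi_relayFading_map] at key
  rw [← key, ← hs.map_eq, Measure.map_map hm hs.measurable]
  rfl

end Channel

lemma measurable_destOut_comp {T : ℕ} {δ : Type*} [MeasurableSpace δ] {f : δ → Fin 2 → Block T}
    {g : δ → Fading T} (hf : Measurable f) (hg : Measurable g) :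
    Measurable fun a => destOut (g a) (f a) := by
  unfold destOut; fun_prop

/-! ### The converse for a code and a cut -/

namespace Code

variable {T n M : ℕ}

/-- The uniform law of the message. -/
def msgLaw (M : ℕ) : Measure (Fin M) := (M : ℝ≥0∞)⁻¹ • Measure.count

lemma lintegral_msgLaw (f : Fin M → ℝ≥0∞) :
    ∫⁻ m, f m ∂(msgLaw M) = (M : ℝ≥0∞)⁻¹ * ∑ m, f m := by
  rw [msgLaw, lintegral_smul_measure, lintegral_count, tsum_fintype, smul_eq_mul]

lemma isProbabilityMeasure_msgLaw (hM : M ≠ 0) : IsProbabilityMeasure (msgLaw M) := by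
  refine ⟨?_⟩
  rw [← lintegral_one, lintegral_msgLaw]
  simp only [Finset.sum_const, Finset.card_univ, Fintype.card_fin, nsmul_eq_mul, mul_one]
  exact ENNReal.inv_mul_cancel (by simpa) (by simp)

instance : IsFiniteMeasure (msgLaw M) := by
  rcases Nat.eq_zero_or_pos M with rfl | hM
  · refine ⟨?_⟩
    rw [← lintegral_one, lintegral_msgLaw]
    simp
  · have := isProbabilityMeasure_msgLaw hM.ne'
    infer_instance

variable (c : Code T n M) (ρsr ρrd : Fin 2 → ℝ≥0)

/-- The blocks sent by the relays, as a function of all the blocks that they receive. -/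
def relayMap (y : Fin n → Fin 2 → Block T) : Fin n → Fin 2 → Block T :=
  fun k i => c.relay i (fun l => y l i) k

lemma measurable_relayMap : Measurable c.relayMap := by
  refine measurable_pi_lambda _ fun k => measurable_pi_lambda _ fun i => ?_
  exact (measurable_pi_apply k).comp ((c.relay_measurable i).comp (by fun_prop))

variable (κR ηR : Kernel (Block T) (Fin 2 → Block T))
  (κD ηD : Kernel (Fin 2 → Block T) (Block T)) [IsMarkovKernel κD] [IsMarkovKernel ηD]

/-- Law of the relay outputs and the destination output given the message, when the relays are
reached through `κR` and the destination through `κD`. -/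
def outputKernel : Kernel (Fin M) ((Fin n → Fin 2 → Block T) × (Fin n → Block T)) :=
  Kernel.ofFunOfCountable fun m =>
    (Measure.pi fun k => κR (c.enc m k)) ⊗ₘ blockKernel κD c.relayMap c.measurable_relayMap

lemma outputKernel_apply (m : Fin M) : c.outputKernel κR κD m =
    (Measure.pi fun k => κR (c.enc m k)) ⊗ₘ blockKernel κD c.relayMap c.measurable_relayMap :=
  rfl

variable [IsMarkovKernel κR] [IsMarkovKernel ηR]

instance : IsMarkovKernel (c.outputKernel κR κD) :=
  ⟨fun m => by rw [outputKernel_apply]; infer_instance⟩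

/-- Joint law of the message, the relay outputs and the destination output. -/
def codeLaw : Measure (Fin M × (Fin n → Fin 2 → Block T) × (Fin n → Block T)) :=
  msgLaw M ⊗ₘ c.outputKernel κR κD

lemma isProbabilityMeasure_codeLaw (hM : M ≠ 0) : IsProbabilityMeasure (c.codeLaw κR κD) := by
  have := isProbabilityMeasure_msgLaw hM
  unfold codeLaw; infer_instance

/-- Chain rule: the message law is common and costs nothing, each stage is a product over blocks and
so additive, and the second stage is averaged over the relay outputs of the first of the two laws.
-/
lemma klDiv_codeLaw : klDiv (c.codeLaw κR κD) (c.codeLaw ηR ηD) = (M : ℝ≥0∞)⁻¹ *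
    ∑ m, ∑ k, (klDiv (κR (c.enc m k)) (ηR (c.enc m k)) +
      ∫⁻ y, klDiv (κD (c.relayMap y k)) (ηD (c.relayMap y k))
        ∂(Measure.pi fun k => κR (c.enc m k))) := by
  have hm (k : Fin n) : Measurable fun y => klDiv (κD (c.relayMap y k)) (ηD (c.relayMap y k)) :=
    (measurable_klDiv κD ηD).comp ((measurable_pi_apply k).comp c.measurable_relayMap)
  rw [codeLaw, codeLaw, klDiv_compProd_eq_lintegral, lintegral_msgLaw]
  congr 1
  refine Finset.sum_congr rfl fun m _ => ?_
  rw [outputKernel_apply, outputKernel_apply, klDiv_compProd_eq_add, klDiv_pi,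
    klDiv_compProd_eq_lintegral, Finset.sum_add_distrib]
  simp_rw [blockKernel_apply, klDiv_pi]
  rw [lintegral_finsetSum _ fun k _ => hm k]

lemma measurable_relayOutputs (m : Fin M) :
    Measurable fun (z : Fin n → Fading T) (k : Fin n) => relayOut (z k) (c.enc m k) :=
  measurable_pi_lambda _ fun k => (measurable_relayOut.comp measurable_prodMk_left).comp
    (measurable_pi_apply k)

lemma measurable_destRx (m : Fin M) : Measurable (c.destRx m) := by
  refine measurable_pi_iff.mpr fun k => ?_
  have h₁ : Measurable fun z : Fin n → Fading T =>
      c.relayMap (fun l => relayOut (z l) (c.enc m l)) k :=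
    measurable_pi_iff.mp (c.measurable_relayMap.comp (c.measurable_relayOutputs m)) k
  have h₂ : Measurable fun z : Fin n → Fading T => z k := measurable_pi_apply k
  exact measurable_destOut_comp h₁ h₂

/-- The event of correct decoding. -/
def correct : Set (Fin M × (Fin n → Fin 2 → Block T) × (Fin n → Block T)) :=
  {p | c.dec p.2.2 = p.1}

lemma measurableSet_correct : MeasurableSet c.correct :=
  measurableSet_eq_fun (c.dec_measurable.comp (measurable_snd.comp measurable_snd)) measurable_fst

lemma codeLaw_compl_correct :
    c.codeLaw (relaysKernel ρsr) (destKernel ρrd) c.correctᶜ = c.errorProb ρsr ρrd := by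
  rw [codeLaw, Measure.compProd_apply c.measurableSet_correct.compl, lintegral_msgLaw, errorProb,
    ENNReal.div_eq_inv_mul]
  congr 1
  refine Finset.sum_congr rfl fun m _ => ?_
  rw [outputKernel_apply, ← channelLaw_map_outputs ρsr ρrd (c.enc m) c.measurable_relayMap,
    Measure.map_apply]
  · rfl
  · exact (c.measurable_relayOutputs m).prodMk (c.measurable_destRx m)
  · exact measurable_prodMk_left c.measurableSet_correct.compl

end Code

/-- Keep the outputs of the relays in `D` and erase the others. -/
def mask {T : ℕ} (D : Finset (Fin 2)) (y : Fin 2 → Block T) : Fin 2 → Block T :=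
  fun i => if i ∈ D then y i else 0

lemma measurable_mask {T : ℕ} (D : Finset (Fin 2)) : Measurable (mask (T := T) D) := by
  refine measurable_pi_lambda _ fun i => ?_
  unfold mask
  split_ifs
  · exact measurable_pi_apply i
  · exact measurable_const

/-- Simulated channels `ηR`, `ηD` that carry no information across the cut whose far side consists
of the relays in `D` and of the destination. -/
structure CutChannel {T : ℕ} (D : Finset (Fin 2)) (ηR : Kernel (Block T) (Fin 2 → Block T))
    (ηD : Kernel (Fin 2 → Block T) (Block T)) : Prop where
  relay_const : ∀ x x', (ηR x).map (mask D) = (ηR x').map (mask D)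
  dest_congr : ∀ x x', (∀ i ∈ D, x i = x' i) → ηD x = ηD x'

/-! ### Success probability under a simulated cut, and reduction to one block -/

namespace Code

variable {T n M : ℕ} (c : Code T n M) (ρsr ρrd : Fin 2 → ℝ≥0)
  {D : Finset (Fin 2)}
  {ηR : Kernel (Block T) (Fin 2 → Block T)} {ηD : Kernel (Fin 2 → Block T) (Block T)}
  [IsMarkovKernel ηR] [IsMarkovKernel ηD]

/-- The decision depends on the relay outputs only through those in `D`, whose law is the same for
all messages. The acceptance probabilities of the messages are thus averaged over one law, and they
sum to at most 1. -/
lemma codeLaw_correct_le (h : CutChannel D ηR ηD) :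
    c.codeLaw ηR ηD c.correct ≤ (M : ℝ≥0∞)⁻¹ := by
  let G (m : Fin M) (y : Fin n → Fin 2 → Block T) : ℝ≥0∞ :=
    blockKernel ηD c.relayMap c.measurable_relayMap y {w | c.dec w = m}
  have hdec (m : Fin M) : MeasurableSet {w | c.dec w = m} :=
    c.dec_measurable (measurableSet_singleton m)
  have hG (m : Fin M) : Measurable (G m) := Kernel.measurable_coe _ (hdec m)
  -- A relay in `D` acts on its own outputs alone, which the mask keeps, and the simulated
  -- destination depends on the inputs of these relays only.
  have hGm (m : Fin M) (y : Fin n → Fin 2 → Block T) : G m y = G m (fun k => mask D (y k)) := by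
    simp only [G, blockKernel_apply]
    congr 2
    ext1 k
    refine h.dest_congr _ _ fun i hi => ?_
    simp [relayMap, mask, hi]
  have hmask : Measurable fun (y : Fin n → Fin 2 → Block T) k => mask D (y k) :=
    measurable_pi_lambda _ fun k => (measurable_mask D).comp (measurable_pi_apply k)
  have (x : Block T) : IsProbabilityMeasure ((ηR x).map (mask D)) :=
    Measure.isProbabilityMeasure_map (measurable_mask D).aemeasurable
  let ν : Measure (Fin n → Fin 2 → Block T) := Measure.pi fun _ => (ηR 0).map (mask D)
  have hint (m : Fin M) : ∫⁻ y, G m y ∂(Measure.pi fun k => ηR (c.enc m k)) = ∫⁻ y, G m y ∂ν := by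
    rw [lintegral_congr (hGm m), ← lintegral_map (hG m) hmask,
      Measure.pi_map_pi (f := fun _ => mask D) fun _ => (measurable_mask D).aemeasurable]
    simp_rw [h.relay_const _ 0]
    rfl
  have hsum (y : Fin n → Fin 2 → Block T) : ∑ m, G m y ≤ 1 := by
    have := sum_measure_preimage_singleton
      (μ := blockKernel ηD c.relayMap c.measurable_relayMap y) (f := c.dec) Finset.univ
      fun m _ => hdec m
    refine (this.trans ?_).le
    simp
  rw [codeLaw, Measure.compProd_apply c.measurableSet_correct, lintegral_msgLaw]
  calc _ = (M : ℝ≥0∞)⁻¹ * ∑ m, ∫⁻ y, G m y ∂ν := by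
        congr 1
        refine Finset.sum_congr rfl fun m _ => ?_
        rw [outputKernel_apply,
          Measure.compProd_apply (measurable_prodMk_left c.measurableSet_correct), ← hint]
        rfl
    _ = (M : ℝ≥0∞)⁻¹ * ∫⁻ y, ∑ m, G m y ∂ν := by rw [lintegral_finsetSum _ fun m _ => hG m]
    _ ≤ (M : ℝ≥0∞)⁻¹ * ∫⁻ _, 1 ∂ν := by gcongr with y; exact hsum y
    _ = _ := by simp

/-- Sum over the blocks of the laws of the channel inputs, averaged over the messages. -/
def inputLaw : Measure (Input T) :=
  (M : ℝ≥0∞)⁻¹ • ∑ m, ∑ k, (channelLaw T n ρsr ρrd).map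
    fun z => (c.enc m k, fun i => c.relayTx m z i k)

lemma measurable_input (m : Fin M) (k : Fin n) :
    Measurable fun z : Fin n → Fading T => (c.enc m k, fun i => c.relayTx m z i k) :=
  measurable_const.prodMk ((measurable_pi_apply k).comp
    (c.measurable_relayMap.comp (c.measurable_relayOutputs m)))

lemma lintegral_inputLaw {f : Input T → ℝ≥0∞} (hf : Measurable f) :
    ∫⁻ x, f x ∂(c.inputLaw ρsr ρrd) = (M : ℝ≥0∞)⁻¹ * ∑ m, ∑ k,
      ∫⁻ z, f (c.enc m k, fun i => c.relayTx m z i k) ∂(channelLaw T n ρsr ρrd) := by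
  rw [inputLaw, lintegral_smul_measure, lintegral_finsetSum_measure, smul_eq_mul]
  simp_rw [lintegral_finsetSum_measure]
  congr 1
  exact Finset.sum_congr rfl fun m _ => Finset.sum_congr rfl fun k _ =>
    lintegral_map hf (c.measurable_input m k)

instance : IsProbabilityMeasure (channelLaw T n ρsr ρrd) := by
  unfold channelLaw; infer_instance

lemma channelLaw_map_relayOutputs (m : Fin M) :
    (channelLaw T n ρsr ρrd).map (fun z k => relayOut (z k) (c.enc m k)) =
      Measure.pi fun k => relaysKernel ρsr (c.enc m k) := by
  have hs := (measurePreserving_fst (ν := Measure.pi fun _ : Fin n => destFading ρrd T)).comp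
    (measurePreserving_splitFading_pi (T := T) ρsr ρrd n)
  rw [← pi_pi_relayFading_map, ← hs.map_eq, Measure.map_map (by fun_prop) hs.measurable]
  rfl

/-- Each block's term depends only on the inputs of that block, so the sum over blocks is linear in
the summed input law. -/
lemma klDiv_codeLaw_eq_lintegral :
    klDiv (c.codeLaw (relaysKernel ρsr) (destKernel ρrd)) (c.codeLaw ηR ηD) =
      ∫⁻ x, klDiv (relaysKernel ρsr x.1) (ηR x.1) + klDiv (destKernel ρrd x.2) (ηD x.2)
        ∂(c.inputLaw ρsr ρrd) := by
  have hR : Measurable fun x : Input T => klDiv (relaysKernel ρsr x.1) (ηR x.1) :=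
    (measurable_klDiv (relaysKernel ρsr) ηR).comp measurable_fst
  have hD := measurable_klDiv (destKernel (T := T) ρrd) ηD
  have hsum : Measurable fun x : Input T =>
      klDiv (relaysKernel ρsr x.1) (ηR x.1) + klDiv (destKernel ρrd x.2) (ηD x.2) :=
    hR.add (hD.comp measurable_snd)
  rw [lintegral_inputLaw _ _ _ hsum, klDiv_codeLaw]
  congr 1
  refine Finset.sum_congr rfl fun m _ => Finset.sum_congr rfl fun k _ => ?_
  dsimp only
  have hDk : Measurable fun y =>
      klDiv (destKernel ρrd (c.relayMap y k)) (ηD (c.relayMap y k)) :=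
    hD.comp ((measurable_pi_apply k).comp c.measurable_relayMap)
  rw [lintegral_add_left measurable_const, ← c.channelLaw_map_relayOutputs ρsr ρrd,
    lintegral_map hDk (c.measurable_relayOutputs m), lintegral_const, measure_univ, mul_one]
  rfl

/-- The converse: the divergence of the true channels from simulated ones that carry no information
across a cut is at least the information that the code conveys. -/
lemma log_card_le_lintegral_klDiv (hM : M ≠ 0) (h : CutChannel D ηR ηD) :
    ENNReal.ofReal ((1 - (c.errorProb ρsr ρrd).toReal) * Real.log M - Real.log 2) ≤
      ∫⁻ x, klDiv (relaysKernel ρsr x.1) (ηR x.1) + klDiv (destKernel ρrd x.2) (ηD x.2)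
        ∂(c.inputLaw ρsr ρrd) := by
  have := c.isProbabilityMeasure_codeLaw (relaysKernel ρsr) (destKernel ρrd) hM
  have := c.isProbabilityMeasure_codeLaw ηR ηD hM
  have hM1 : (1 : ℝ) ≤ M := by exact_mod_cast Nat.one_le_iff_ne_zero.mpr hM
  rw [← klDiv_codeLaw_eq_lintegral, ← codeLaw_compl_correct, ← measureReal_def,
    probReal_compl_eq_one_sub c.measurableSet_correct, sub_sub_cancel]
  refine mul_log_sub_log_two_le_klDiv _ _ c.measurableSet_correct hM1 ?_
  have hle := ENNReal.toReal_mono (by simpa using hM) (c.codeLaw_correct_le h)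
  rw [← measureReal_def, ENNReal.toReal_inv, ENNReal.toReal_natCast] at hle
  calc _ ≤ (M : ℝ)⁻¹ * M := by gcongr
    _ = 1 := inv_mul_cancel₀ (by positivity)

end Code

/-! ### Mutual informations as average divergences -/

section Information

variable {Ω α β γ : Type*} [MeasurableSpace Ω] [MeasurableSpace α] [MeasurableSpace β]
  [MeasurableSpace γ] {P : Measure Ω} [IsProbabilityMeasure P] {X : Ω → α} {Y : Ω → β} {Z : Ω → γ}

lemma ofReal_log_two_ne_zero : ENNReal.ofReal (Real.log 2) ≠ 0 := by
  simpa using Real.log_pos one_lt_two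

/-- `κ` is a conditional law of `Y` given `X`, and the product of the marginals is a constant kernel
over the law of `X`. The factor log 2 converts bits to nats. -/
lemma log_two_mul_mutualInfo [MeasurableSpace.CountableOrCountablyGenerated α β]
    (hX : Measurable X) (hY : Measurable Y) (κ : Kernel α β) [IsMarkovKernel κ]
    (h : P.map (fun ω => (X ω, Y ω)) = P.map X ⊗ₘ κ) :
    ENNReal.ofReal (Real.log 2) * mutualInfo X Y P =
      ∫⁻ ω, klDiv (κ (X ω)) (P.map Y) ∂P := by
  have := Measure.isProbabilityMeasure_map (μ := P) hY.aemeasurable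
  rw [mutualInfo, ENNReal.mul_div_cancel ofReal_log_two_ne_zero ENNReal.ofReal_ne_top, h,
    ← Measure.compProd_const, klDiv_compProd_eq_lintegral,
    lintegral_map (measurable_klDiv _ _) hX]
  rfl

/-- Regroups the conditionally independent reference law as the law of (Z, X) followed by a kernel
for Y that ignores X. Both laws in a conditional mutual information then share the marginal of (Z,
X). -/
lemma compProd_prod_map_assoc (μ : Measure γ) [IsFiniteMeasure μ] (κ : Kernel γ α)
    (η : Kernel γ β) [IsFiniteKernel κ] [IsFiniteKernel η] :
    (μ ⊗ₘ (κ ×ₖ η)).map MeasurableEquiv.prodAssoc.symm =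
      (μ ⊗ₘ κ) ⊗ₘ η.comap Prod.fst measurable_fst := by
  ext s hs
  rw [MeasurableEquiv.map_apply,
    Measure.compProd_apply (MeasurableEquiv.prodAssoc.symm.measurable hs),
    Measure.compProd_apply hs, Measure.lintegral_compProd
      (Kernel.measurable_kernel_prodMk_left hs)]
  refine lintegral_congr fun z => ?_
  rw [Kernel.prod_apply' _ _ _ (measurable_prodMk_left
    (MeasurableEquiv.prodAssoc.symm.measurable hs))]
  rfl

lemma log_two_mul_condMutualInfo [StandardBorelSpace α] [Nonempty α] [StandardBorelSpace β]
    [Nonempty β] (hX : Measurable X) (hY : Measurable Y) (hZ : Measurable Z)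
    (κ : Kernel (γ × α) β) [IsMarkovKernel κ]
    (h : P.map (fun ω => ((Z ω, X ω), Y ω)) = P.map (fun ω => (Z ω, X ω)) ⊗ₘ κ) :
    ENNReal.ofReal (Real.log 2) * condMutualInfo X Y Z P =
      ∫⁻ ω, klDiv (κ (Z ω, X ω)) (condDistrib Y Z P (Z ω)) ∂P := by
  rw [condMutualInfo, ENNReal.mul_div_cancel ofReal_log_two_ne_zero ENNReal.ofReal_ne_top,
    ← klDiv_map_measurableEquiv MeasurableEquiv.prodAssoc.symm, compProd_prod_map_assoc,
    compProd_map_condDistrib hX.aemeasurable,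
    Measure.map_map MeasurableEquiv.prodAssoc.symm.measurable (hZ.prodMk (hX.prodMk hY))]
  change klDiv (P.map fun ω => ((Z ω, X ω), Y ω)) _ = _
  rw [h, klDiv_compProd_eq_lintegral, lintegral_map (measurable_klDiv _ _) (hZ.prodMk hX)]
  rfl

end Information

/-! ### The cuts of the diamond network -/

section Cuts

variable {T : ℕ} (ρsr ρrd : Fin 2 → ℝ≥0) (p : ProbabilityMeasure (Input T))

lemma measurable_XS : Measurable (XS (T := T)) := measurable_fst.comp measurable_fst

lemma measurable_XR : Measurable (XR (T := T)) := measurable_snd.comp measurable_fst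

lemma measurable_YR : Measurable (YR (T := T)) := by
  unfold YR relayOut; fun_prop

lemma measurable_YD : Measurable (YD (T := T)) :=
  measurable_destOut_comp measurable_XR measurable_snd

lemma jointLaw_map_fst : (jointLaw ρsr ρrd p).map Prod.fst = p := by
  rw [jointLaw, Measure.map_fst_prod]; simp

lemma lintegral_jointLaw {f : Input T → ℝ≥0∞} (hf : Measurable f) :
    ∫⁻ ω, f ω.1 ∂(jointLaw ρsr ρrd p) = ∫⁻ x, f x ∂(p : Measure (Input T)) := by
  rw [← lintegral_map hf measurable_fst, jointLaw_map_fst]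

lemma jointLaw_map_comp_fst {α : Type*} [MeasurableSpace α] {f : Input T → α}
    (hf : Measurable f) :
    (jointLaw ρsr ρrd p).map (fun ω => f ω.1) = (p : Measure (Input T)).map f := by
  rw [← jointLaw_map_fst ρsr ρrd p, Measure.map_map hf measurable_fst]; rfl

lemma jointLaw_map_XS_YR : (jointLaw ρsr ρrd p).map (fun ω => (XS ω, YR ω)) =
    (jointLaw ρsr ρrd p).map XS ⊗ₘ relaysKernel ρsr := by
  have h := map_prod_eq_compProd (fadingLaw T ρsr ρrd) (p : Measure (Input T)) measurable_fst
    measurable_relayOut (relaysKernel ρsr) (fadingLaw_map_relayOut ρsr ρrd)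
  rw [← jointLaw_map_comp_fst ρsr ρrd p measurable_fst] at h
  exact h

lemma jointLaw_map_XS_YR_apply (i : Fin 2) :
    (jointLaw ρsr ρrd p).map (fun ω => (XS ω, YR ω i)) =
      (jointLaw ρsr ρrd p).map XS ⊗ₘ relayKernel ρsr i := by
  have hg : Measurable (Function.uncurry fun (x : Block T) (z : Fading T) => relayOut z x i) :=
    (measurable_pi_apply i).comp measurable_relayOut
  have h := map_prod_eq_compProd (fadingLaw T ρsr ρrd) (p : Measure (Input T)) measurable_fst
    hg (relayKernel ρsr i) (fun x => fadingLaw_map_relayOut_apply ρsr ρrd x i)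
  rw [← jointLaw_map_comp_fst ρsr ρrd p measurable_fst] at h
  exact h

/-- Leaving `f` free covers both conditioning on the relay inputs as they are and on the pair with a
chosen relay first; `r` recovers the relay inputs. -/
lemma jointLaw_map_YD {α : Type*} [MeasurableSpace α] {f : Input T → α} (hf : Measurable f)
    {r : α → Fin 2 → Block T} (hr : Measurable r) (hrf : ∀ x, r (f x) = x.2) :
    (jointLaw ρsr ρrd p).map (fun ω => (f ω.1, YD ω)) =
      (jointLaw ρsr ρrd p).map (fun ω => f ω.1) ⊗ₘ (destKernel ρrd).comap r hr := by
  have hg : Measurable (Function.uncurry fun (a : α) (z : Fading T) => destOut z (r a)) :=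
    measurable_destOut_comp (hr.comp measurable_fst) measurable_snd
  have h := map_prod_eq_compProd (fadingLaw T ρsr ρrd) (p : Measure (Input T)) hf hg
    ((destKernel ρrd).comap r hr) fun a => fadingLaw_map_destOut ρsr ρrd (r a)
  rw [← jointLaw_map_comp_fst ρsr ρrd p hf] at h
  rw [← h]
  simp only [hrf]
  rfl

/-- The relays other than `i` are reached through the true channel, relay `i` receives `q`. -/
def simulatedRelay (i : Fin 2) (q : Measure (Block T)) (l : Fin 2) :
    Kernel (Block T) (Block T) :=
  if l = i then Kernel.const _ q else relayKernel ρsr l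

instance (i : Fin 2) (q : Measure (Block T)) [IsProbabilityMeasure q] (l : Fin 2) :
    IsMarkovKernel (simulatedRelay ρsr i q l) := by
  unfold simulatedRelay; split_ifs <;> infer_instance

lemma cutChannel_univ (q : Measure (Fin 2 → Block T)) :
    CutChannel Finset.univ (Kernel.const _ q) (destKernel (T := T) ρrd) where
  relay_const _ _ := rfl
  dest_congr x x' h := by rw [show x = x' from funext fun i => h i (Finset.mem_univ i)]

lemma cutChannel_empty (q : Measure (Block T)) :
    CutChannel ∅ (relaysKernel (T := T) ρsr) (Kernel.const _ q) where
  relay_const x x' := by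
    have : mask (T := T) ∅ = fun _ => 0 := by ext; simp [mask]
    rw [this, Measure.map_const, Measure.map_const]
    simp
  dest_congr _ _ _ := rfl

/-- Relay `i` receives noise of law `q`, independent of the source, and the destination sees the
input of relay `i` only. The other relay keeps its true channel, which carries nothing across the
cut. -/
lemma cutChannel_singleton (i : Fin 2) (q : Measure (Block T)) [IsProbabilityMeasure q]
    (η : Kernel (Block T) (Block T)) :
    CutChannel {i} (piKernel (simulatedRelay ρsr i q))
      (η.comap (fun x : Fin 2 → Block T => x i) (measurable_pi_apply i)) where
  relay_const x x' := by
    let φ (l : Fin 2) (b : Block T) : Block T := if l ∈ ({i} : Finset (Fin 2)) then b else 0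
    have hφ (l : Fin 2) : Measurable (φ l) := by
      simp only [φ]; split_ifs
      · exact measurable_id
      · exact measurable_const
    have (x : Block T) (l : Fin 2) :
        IsProbabilityMeasure ((simulatedRelay ρsr i q l x).map (φ l)) :=
      Measure.isProbabilityMeasure_map (hφ l).aemeasurable
    have hpi (x : Block T) : (piKernel (simulatedRelay ρsr i q) x).map (mask {i}) =
        Measure.pi fun l => (simulatedRelay ρsr i q l x).map (φ l) := by
      rw [piKernel_apply, ← Measure.pi_map_pi fun l => (hφ l).aemeasurable]
      rfl
    rw [hpi, hpi]
    congr 1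
    ext1 l
    by_cases hl : l = i
    · simp [simulatedRelay, hl]
    · have : φ l = fun _ => 0 := by ext; simp [φ, hl]
      rw [this, Measure.map_const, Measure.map_const]
      simp
  dest_congr x x' h := by simp [Kernel.comap_apply, h i]

/-- The true and simulated product laws differ in the factor `i` only. -/
lemma klDiv_simulatedRelay (i : Fin 2) (q : Measure (Block T)) [IsProbabilityMeasure q]
    (x : Block T) :
    klDiv (relaysKernel ρsr x) (piKernel (simulatedRelay ρsr i q) x) =
      klDiv (relayKernel ρsr i x) q := by
  rw [relaysKernel, piKernel_apply, piKernel_apply, klDiv_pi, Finset.sum_eq_single i]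
  · simp [simulatedRelay]
  · intro l _ hl
    simp [simulatedRelay, hl]
  · simp

/-- `D` and the simulated channels attain the value `v` (in bits) of a cut. -/
def IsCutValue (v : ℝ≥0∞) : Prop :=
  ∃ (D : Finset (Fin 2)) (ηR : Kernel (Block T) (Fin 2 → Block T))
    (ηD : Kernel (Fin 2 → Block T) (Block T)),
    IsMarkovKernel ηR ∧ IsMarkovKernel ηD ∧ CutChannel D ηR ηD ∧
    ∫⁻ x, klDiv (relaysKernel ρsr x.1) (ηR x.1) + klDiv (destKernel ρrd x.2) (ηD x.2)
      ∂(p : Measure (Input T)) = ENNReal.ofReal (Real.log 2) * v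

lemma isCutValue_mutualInfo_XS_YR :
    IsCutValue ρsr ρrd p (mutualInfo XS YR (jointLaw ρsr ρrd p)) := by
  have := Measure.isProbabilityMeasure_map (μ := jointLaw ρsr ρrd p)
    (measurable_YR (T := T)).aemeasurable
  refine ⟨_, _, _, inferInstance, inferInstance,
    cutChannel_univ ρrd ((jointLaw ρsr ρrd p).map YR), ?_⟩
  rw [log_two_mul_mutualInfo measurable_XS measurable_YR _ (jointLaw_map_XS_YR ρsr ρrd p),
    ← lintegral_jointLaw ρsr ρrd]
  · simp only [klDiv_self, add_zero, Kernel.const_apply]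
    rfl
  · simp only [klDiv_self, add_zero]
    exact (measurable_klDiv _ _).comp measurable_fst

lemma isCutValue_mutualInfo_XR_YD :
    IsCutValue ρsr ρrd p (mutualInfo XR YD (jointLaw ρsr ρrd p)) := by
  have := Measure.isProbabilityMeasure_map (μ := jointLaw ρsr ρrd p)
    (measurable_YD (T := T)).aemeasurable
  refine ⟨_, _, _, inferInstance, inferInstance,
    cutChannel_empty ρsr ((jointLaw ρsr ρrd p).map YD), ?_⟩
  have h := jointLaw_map_YD ρsr ρrd p measurable_snd measurable_id fun _ => rfl
  rw [log_two_mul_mutualInfo measurable_XR measurable_YD _ h, ← lintegral_jointLaw ρsr ρrd]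
  · simp only [klDiv_self, zero_add, Kernel.const_apply]
    rfl
  · simp only [klDiv_self, zero_add]
    exact (measurable_klDiv _ _).comp measurable_snd

/-- The simulated laws are that of `Y_{R_i}` and the conditional law of `Y_D` given `X_{R_i}`, so
the two divergence terms average to the two informations. -/
lemma isCutValue_mixed {i j : Fin 2} (hij : j ≠ i) :
    IsCutValue ρsr ρrd p (mutualInfo XS (fun ω => YR ω i) (jointLaw ρsr ρrd p) +
      condMutualInfo (fun ω => XR ω j) YD (fun ω => XR ω i) (jointLaw ρsr ρrd p)) := by
  have hYi : Measurable fun ω : Input T × Fading T => YR ω i :=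
    (measurable_pi_apply i).comp measurable_YR
  have hX (l : Fin 2) : Measurable fun ω : Input T × Fading T => XR ω l :=
    (measurable_pi_apply l).comp measurable_XR
  have := Measure.isProbabilityMeasure_map (μ := jointLaw ρsr ρrd p) hYi.aemeasurable
  refine ⟨_, _, _, inferInstance, inferInstance,
    cutChannel_singleton ρsr i ((jointLaw ρsr ρrd p).map fun ω => YR ω i)
      (condDistrib YD (fun ω => XR ω i) (jointLaw ρsr ρrd p)), ?_⟩
  -- Puts the pair (X_{R_i}, X_{R_j}), conditioning variable first, back in the order of the relay
  -- indices.
  let r : Block T × Block T → Fin 2 → Block T := fun q l => if l = i then q.1 else q.2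
  have hr : Measurable r := by
    refine measurable_pi_lambda _ fun l => ?_
    simp only [r]
    split_ifs
    · exact measurable_fst
    · exact measurable_snd
  have hrf (x : Input T) : r (x.2 i, x.2 j) = x.2 := by
    ext1 l
    by_cases hl : l = i
    · simp [r, hl]
    · have : l = j := by omega
      simp [r, this, hij]
  have hf : Measurable fun x : Input T => (x.2 i, x.2 j) := by fun_prop
  have h := jointLaw_map_YD ρsr ρrd p hf hr hrf
  have hR : Measurable fun x : Input T =>
      klDiv (relayKernel ρsr i x.1) ((jointLaw ρsr ρrd p).map fun ω => YR ω i) :=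
    (measurable_klDiv (relayKernel ρsr i) (Kernel.const _ _)).comp measurable_fst
  have hD : Measurable fun x : Input T => klDiv (destKernel ρrd x.2)
      (condDistrib YD (fun ω => XR ω i) (jointLaw ρsr ρrd p) (x.2 i)) :=
    (measurable_klDiv (destKernel ρrd) ((condDistrib YD (fun ω => XR ω i)
      (jointLaw ρsr ρrd p)).comap (fun x : Fin 2 → Block T => x i)
        (measurable_pi_apply i))).comp measurable_snd
  rw [mul_add, log_two_mul_mutualInfo measurable_XS hYi _ (jointLaw_map_XS_YR_apply ρsr ρrd p i),
    log_two_mul_condMutualInfo (hX j) measurable_YD (hX i) _ h]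
  simp only [klDiv_simulatedRelay, Kernel.comap_apply]
  rw [lintegral_add_left hR, ← lintegral_jointLaw ρsr ρrd p hR, ← lintegral_jointLaw ρsr ρrd p hD]
  congr 1
  refine lintegral_congr fun ω => ?_
  rw [show r (XR ω i, XR ω j) = ω.1.2 from hrf ω.1]
  rfl

/-- The minimum is one of its four arguments, and each of these is a cut value for the same `p`. -/
lemma isCutValue_minCut : IsCutValue ρsr ρrd p (minCut (jointLaw ρsr ρrd p)) := by
  unfold minCut
  rcases min_choice (min (mutualInfo XS YR (jointLaw ρsr ρrd p))
      (mutualInfo XS (fun ω => YR ω 1) (jointLaw ρsr ρrd p) +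
        condMutualInfo (fun ω => XR ω 0) YD (fun ω => XR ω 1) (jointLaw ρsr ρrd p)))
    (min (mutualInfo XS (fun ω => YR ω 0) (jointLaw ρsr ρrd p) +
        condMutualInfo (fun ω => XR ω 1) YD (fun ω => XR ω 0) (jointLaw ρsr ρrd p))
      (mutualInfo XR YD (jointLaw ρsr ρrd p))) with h | h
  · rw [h]
    rcases min_choice (mutualInfo XS YR (jointLaw ρsr ρrd p))
      (mutualInfo XS (fun ω => YR ω 1) (jointLaw ρsr ρrd p) +
        condMutualInfo (fun ω => XR ω 0) YD (fun ω => XR ω 1) (jointLaw ρsr ρrd p)) with h | h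
    · rw [h]; exact isCutValue_mutualInfo_XS_YR ρsr ρrd p
    · rw [h]; exact isCutValue_mixed ρsr ρrd p (by decide)
  · rw [h]
    rcases min_choice (mutualInfo XS (fun ω => YR ω 0) (jointLaw ρsr ρrd p) +
        condMutualInfo (fun ω => XR ω 1) YD (fun ω => XR ω 0) (jointLaw ρsr ρrd p))
      (mutualInfo XR YD (jointLaw ρsr ρrd p)) with h | h
    · rw [h]; exact isCutValue_mixed ρsr ρrd p (by decide)
    · rw [h]; exact isCutValue_mutualInfo_XR_YD ρsr ρrd p

end Cuts

/-! ### The single-letter bound for a code -/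

lemma exists_energy_eq {T : ℕ} (hT : 0 < T) {e : ℝ≥0∞} (he : e ≠ ∞) :
    ∃ x : Block T, energy x = e := by
  refine ⟨Pi.single ⟨0, hT⟩ (Real.sqrt e.toReal : ℂ), ?_⟩
  rw [energy, Finset.sum_eq_single ⟨0, hT⟩]
  · rw [Pi.single_eq_same, ← ofReal_norm, Complex.norm_real,
      Real.norm_of_nonneg (Real.sqrt_nonneg _), ← ENNReal.ofReal_pow (Real.sqrt_nonneg _),
      Real.sq_sqrt ENNReal.toReal_nonneg, ENNReal.ofReal_toReal he]
  · intro t _ ht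
    simp [Pi.single_eq_of_ne ht]
  · simp

lemma measurable_energy {T : ℕ} : Measurable (energy (T := T)) := by
  unfold energy; fun_prop

lemma inv_mul_add_tsub_cancel {a N t : ℝ≥0∞} (hN : N ≠ 0) (hN' : N ≠ ∞) (h : a ≤ N * t) :
    N⁻¹ * (a + (N * t - a)) = t := by
  rw [add_tsub_cancel_of_le h, ← mul_assoc, ENNReal.inv_mul_cancel hN hN', one_mul]

namespace Code

variable {T n M : ℕ} (c : Code T n M) (ρsr ρrd : Fin 2 → ℝ≥0)

lemma inputLaw_univ (hM : M ≠ 0) : c.inputLaw ρsr ρrd Set.univ = n := by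
  rw [← lintegral_one, lintegral_inputLaw _ _ _ measurable_const]
  simp only [lintegral_one, measure_univ, Finset.sum_const, Finset.card_univ, Fintype.card_fin,
    nsmul_eq_mul, mul_one]
  rw [← mul_assoc, ENNReal.inv_mul_cancel (by simpa) (by simp), one_mul]

/-- The block inputs of a code, with one more block that uses up the energy that the code leaves,
give an admissible input law. -/
lemma exists_unitPower (hT : 0 < T) (hM : M ≠ 0) (hc : c.MeetsPower ρsr ρrd) :
    ∃ p : ProbabilityMeasure (Input T), UnitPower p ∧ ∀ f : Input T → ℝ≥0∞,
      ∫⁻ x, f x ∂(c.inputLaw ρsr ρrd) ≤ (n + 1 : ℝ≥0∞) * ∫⁻ x, f x ∂(p : Measure (Input T)) := by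
  have hN : (n + 1 : ℝ≥0∞) ≠ 0 := by simp
  have hN' : (n + 1 : ℝ≥0∞) ≠ ∞ := by finiteness
  have hle : (n * T : ℝ≥0∞) ≤ (n + 1) * T := by gcongr; simp
  have hfin : ((n + 1) * T : ℝ≥0∞) ≠ ∞ := by finiteness
  have hES : Measurable fun x : Input T => energy x.1 := measurable_energy.comp measurable_fst
  have hER (i : Fin 2) : Measurable fun x : Input T => energy (x.2 i) :=
    measurable_energy.comp ((measurable_pi_apply i).comp measurable_snd)
  have hS : ∫⁻ x, energy x.1 ∂(c.inputLaw ρsr ρrd) ≤ (n + 1) * T := by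
    refine le_trans (le_of_eq ?_) (hc.1.trans hle)
    rw [lintegral_inputLaw _ _ _ hES, ENNReal.div_eq_inv_mul]
    simp
  have hR (i : Fin 2) : ∫⁻ x, energy (x.2 i) ∂(c.inputLaw ρsr ρrd) ≤ (n + 1) * T := by
    refine le_trans (le_of_eq ?_) ((hc.2 i).trans hle)
    rw [lintegral_inputLaw _ _ _ (hER i), ENNReal.div_eq_inv_mul]
    congr 1
    refine Finset.sum_congr rfl fun m _ => (lintegral_finsetSum _ fun k _ => ?_).symm
    exact (hER i).comp (c.measurable_input m k)
  -- The filler block is deterministic and spends what is left of the energy (n + 1)T; the extra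
  -- block also keeps the normalisation meaningful for n = 0.
  obtain ⟨xS, hxS⟩ := exists_energy_eq hT
    (ENNReal.sub_ne_top (b := ∫⁻ x, energy x.1 ∂(c.inputLaw ρsr ρrd)) hfin)
  choose xR hxR using fun i => exists_energy_eq hT
    (ENNReal.sub_ne_top (b := ∫⁻ x, energy (x.2 i) ∂(c.inputLaw ρsr ρrd)) hfin)
  let μ : Measure (Input T) := (n + 1 : ℝ≥0∞)⁻¹ • (c.inputLaw ρsr ρrd + Measure.dirac (xS, xR))
  have hμ (f : Input T → ℝ≥0∞) (hf : Measurable f) : ∫⁻ x, f x ∂μ =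
      (n + 1 : ℝ≥0∞)⁻¹ * (∫⁻ x, f x ∂(c.inputLaw ρsr ρrd) + f (xS, xR)) := by
    rw [lintegral_smul_measure, lintegral_add_measure, lintegral_dirac' _ hf, smul_eq_mul]
  have hprob : IsProbabilityMeasure μ := by
    refine ⟨?_⟩
    rw [← lintegral_one, hμ _ measurable_const, lintegral_one, inputLaw_univ _ _ _ hM]
    exact ENNReal.inv_mul_cancel hN hN'
  refine ⟨⟨μ, hprob⟩, ⟨?_, fun i => ?_⟩, fun f => ?_⟩
  · exact (hμ _ hES).trans (by rw [hxS]; exact inv_mul_add_tsub_cancel hN hN' hS)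
  · exact (hμ _ (hER i)).trans (by rw [hxR]; exact inv_mul_add_tsub_cancel hN hN' (hR i))
  · change _ ≤ _ * ∫⁻ x, f x ∂μ
    rw [lintegral_smul_measure, lintegral_add_measure, smul_eq_mul, ← mul_assoc,
      ENNReal.mul_inv_cancel hN hN', one_mul]
    exact le_self_add

lemma log_card_le_iSup_minCut (hT : 0 < T) (hM : M ≠ 0) (hc : c.MeetsPower ρsr ρrd) :
    ENNReal.ofReal ((1 - (c.errorProb ρsr ρrd).toReal) * Real.log M - Real.log 2) ≤
      (n + 1 : ℝ≥0∞) * (ENNReal.ofReal (Real.log 2) *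
        ⨆ (p : ProbabilityMeasure (Input T)) (_ : UnitPower p), minCut (jointLaw ρsr ρrd p)) := by
  obtain ⟨p, hp, hle⟩ := c.exists_unitPower ρsr ρrd hT hM hc
  obtain ⟨D, ηR, ηD, _, _, hcut, hval⟩ := isCutValue_minCut ρsr ρrd p
  refine (c.log_card_le_lintegral_klDiv ρsr ρrd hM hcut).trans ((hle _).trans ?_)
  rw [hval]
  gcongr
  exact le_iSup₂ (f := fun (p : ProbabilityMeasure (Input T)) (_ : UnitPower p) =>
    minCut (jointLaw ρsr ρrd p)) p hp

lemma errorProb_le_one (hM : M ≠ 0) : c.errorProb ρsr ρrd ≤ 1 := by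
  have := c.isProbabilityMeasure_codeLaw (relaysKernel ρsr) (destKernel ρrd) hM
  rw [← codeLaw_compl_correct]
  exact prob_le_one

end Code

lemma Achievable.mul_le {T : ℕ} (hT : 0 < T) {ρsr ρrd : Fin 2 → ℝ≥0} {R : ℝ≥0}
    (h : Achievable T ρsr ρrd R) : (T : ℝ≥0∞) * R ≤
      ⨆ (p : ProbabilityMeasure (Input T)) (_ : UnitPower p), minCut (jointLaw ρsr ρrd p) := by
  obtain ⟨c, hpow, herr⟩ := h
  set S := ⨆ (p : ProbabilityMeasure (Input T)) (_ : UnitPower p), minCut (jointLaw ρsr ρrd p)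
    with hS
  by_cases hStop : S = ∞
  · rw [hStop]; exact le_top
  have hlog : 0 < Real.log 2 := Real.log_pos one_lt_two
  have hbound (n : ℕ) : (1 - ((c n).errorProb ρsr ρrd).toReal) * (n * (T * R)) - 1 ≤
      (n + 1) * S.toReal := by
    have hpos : (0 : ℝ) < 2 ^ ((n : ℝ) * T * R) := by positivity
    have hM : ⌈(2 : ℝ) ^ ((n : ℝ) * T * R)⌉₊ ≠ 0 := (Nat.ceil_pos.mpr hpos).ne'
    have h1 := (c n).log_card_le_iSup_minCut ρsr ρrd hT hM (hpow n)
    rw [← hS, ENNReal.ofReal_le_iff_le_toReal (by finiteness)] at h1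
    rw [ENNReal.toReal_mul, ENNReal.toReal_mul, ENNReal.toReal_ofReal hlog.le,
      ENNReal.toReal_add (by finiteness) (by finiteness), ENNReal.toReal_natCast,
      ENNReal.toReal_one] at h1
    have he : ((c n).errorProb ρsr ρrd).toReal ≤ 1 :=
      ENNReal.toReal_le_of_le_ofReal zero_le_one (by simpa using (c n).errorProb_le_one _ _ hM)
    have h2 : n * (T * R) * Real.log 2 ≤ Real.log ⌈(2 : ℝ) ^ ((n : ℝ) * T * R)⌉₊ := by
      rw [← mul_assoc, ← Real.log_rpow two_pos]
      exact Real.log_le_log hpos (Nat.le_ceil _)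
    have h3 := mul_le_mul_of_nonneg_left h2 (sub_nonneg.mpr he)
    -- Division by log 2 returns to bits and turns the slack log 2 into 1.
    refine le_of_mul_le_mul_right ?_ hlog
    linarith
  have hlim : Tendsto (fun n : ℕ => (1 - ((c n).errorProb ρsr ρrd).toReal) * (T * R) -
      1 / (n : ℝ)) atTop (𝓝 ((1 - 0) * (T * R) - 0)) := by
    have he := (ENNReal.tendsto_toReal ENNReal.zero_ne_top).comp herr
    exact ((tendsto_const_nhds.sub he).mul_const _).sub tendsto_one_div_atTop_nhds_zero_nat
  have hlim' : Tendsto (fun n : ℕ => (1 + 1 / (n : ℝ)) * S.toReal) atTop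
      (𝓝 ((1 + 0) * S.toReal)) :=
    (tendsto_const_nhds.add tendsto_one_div_atTop_nhds_zero_nat).mul_const _
  -- `hbound` divided by `n`, which must be positive: the slack becomes 1/n and the filler block the
  -- factor 1 + 1/n.
  have hle := le_of_tendsto_of_tendsto hlim hlim' (by
    filter_upwards [eventually_gt_atTop 0] with n hn
    have hn' : (0 : ℝ) < n := by exact_mod_cast hn
    refine le_of_mul_le_mul_left ?_ hn'
    have := hbound n
    field_simp
    linarith)
  simp only [sub_zero, one_mul, add_zero] at hle
  rw [← ENNReal.ofReal_toReal hStop]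
  refine le_trans (le_of_eq ?_) (ENNReal.ofReal_le_ofReal hle)
  rw [ENNReal.ofReal_mul (by positivity), ENNReal.ofReal_natCast, ENNReal.ofReal_coe_nnreal]

end DiamondNetwork

end

theorem mainTheorem3 (T : ℕ) (hT : 0 < T) (ρsr ρrd : Fin 2 → ℝ≥0) :
    (T : ℝ≥0∞) * DiamondNetwork.capacity T ρsr ρrd ≤
      ⨆ (p : ProbabilityMeasure (DiamondNetwork.Input T)) (_ : DiamondNetwork.UnitPower p),
        DiamondNetwork.minCut (DiamondNetwork.jointLaw ρsr ρrd p) := by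
  rw [DiamondNetwork.capacity, ENNReal.mul_iSup]
  refine iSup_le fun R => ?_
  rw [ENNReal.mul_iSup]
  exact iSup_le fun h => h.mul_le hT
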